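/- Let $\omega:\mathbb{N}\to[1,\infty)$ satisfy $\omega(n)\to\infty$. Let $\mathcal{A}=\ell^1(\mathbb{N}_\wedge,\omega)$ be the Banach space of all $f:\mathbb{N}\to\mathbb{C}$ with $\|f\|=\sum_n|f(n)|\,\omega(n)<\infty$, with the convolution product determined by $\delta_m\star\delta_n=\delta_{\min\{m,n\}}$, and let $c_0(\omega^{-1})$ be the space of all $F:\mathbb{N}\to\mathbb{C}$ with $F(n)/\omega(n)\to0$, acting on $\mathcal{A}$ by $\langle F,f\rangle=\sum_nF(n)f(n)$. A Banach $\mathcal{A}$-bimodule $E$ is *dual* with predual $E_*$ if $E_*$ is a closed submodule of $E^*$ such that $E=(E_*)^*$ through the canonical map; $\mathcal{A}$ is a *dual Banach algebra* if it is dual as a bimodule over itself. A dual bimodule $E$ is *normal* if for each $x\in E$ the maps $a\mapsto a\cdot x$ and $a\mapsto x\cdot a$ from $\mathcal{A}$ to $E$ are $w^*$-continuous. A *derivation* is a bounded linear map $D:\mathcal{A}\to E$ with $D(ab)=D(a)\cdot b+a\cdot D(b)$ for all $a,b\in\mathcal{A}$. Then $\mathcal{A}$ is a dual Banach algebra with predual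 $c_0(\omega^{-1})$, and: (i) $\mathcal{A}$ is not Connes amenable: it is not the case that for every normal dual Banach $\mathcal{A}$-bimodule $E$ and every $w^*$-continuous derivation $D:\mathcal{A}\to E$ there is $x\in E$ with $D(a)=a\cdot x-x\cdot a$ for all $a\in\mathcal{A}$. (ii) $\mathcal{A}$ is not pointwise Connes amenable: it is not the case that for every $a_0\in\mathcal{A}$, every normal dual Banach $\mathcal{A}$-bimodule $E$ and every $w^*$-continuous derivation $D:\mathcal{A}\to E$ there is $x\in E$ with $D(a_0)=a_0\cdot x-x\cdot a_0$. (iii) $\mathcal{A}$ is pointwise $w^*$-approximately Connes amenable: for every $a_0\in\mathcal{A}$, every normal dual Banach $\mathcal{A}$-bimodule $E$ and every $w^*$-continuous derivation $D:\mathcal{A}\to E$ there is a net $(x_i)$ in $E$ with $D(a_0)=w^*\text{-}\lim_i(a_0\cdot x_i-x_i\cdot a_0)$. -/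

import Mathlib

open Filter Topology

/-! ## Banach bimodules, dual Banach algebras and Connes amenability -/

universe u v

section General

/-- The `w*`-topology on `E` determined by a space `P` of functionals on `E`: the coarsest topology
making every `φ ∈ P` continuous. -/
@[reducible]
noncomputable def wstarTopology {E : Type*} [NormedAddCommGroup E] [NormedSpace ℂ E]
    (P : Submodule ℂ (StrongDual ℂ E)) : TopologicalSpace E :=
  TopologicalSpace.induced (fun x (φ : P) => (φ : StrongDual ℂ E) x) Pi.topologicalSpace

/-- A Banach `A`-bimodule structure on `E` (completeness of `E` is assumed where this is used):
`lact a x` is `a · x` and `ract a x` is `x · a`.  The algebra is not assumed to be unital. -/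
structure BanachBimodule (A : Type u) [NonUnitalNormedRing A] [NormedSpace ℂ A]
    (E : Type v) [NormedAddCommGroup E] [NormedSpace ℂ E] where
  lact : A →L[ℂ] E →L[ℂ] E
  ract : A →L[ℂ] E →L[ℂ] E
  lact_mul : ∀ (a b : A) (x : E), lact (a * b) x = lact a (lact b x)
  ract_mul : ∀ (a b : A) (x : E), ract (a * b) x = ract b (ract a x)
  lact_ract : ∀ (a b : A) (x : E), lact a (ract b x) = ract b (lact a x)

namespace BanachBimodule

/-- A Banach algebra as a bimodule over itself. -/
noncomputable def self (A : Type u) [NonUnitalNormedRing A] [NormedSpace ℂ A] [IsScalarTower ℂ A A]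
    [SMulCommClass ℂ A A] : BanachBimodule A A where
  lact := ContinuousLinearMap.mul ℂ A
  ract := (ContinuousLinearMap.mul ℂ A).flip
  lact_mul a b x := by simp [mul_assoc]
  ract_mul a b x := by simp [mul_assoc]
  lact_ract a b x := by simp [mul_assoc]

variable {A : Type u} [NonUnitalNormedRing A] [NormedSpace ℂ A]
  {E : Type v} [NormedAddCommGroup E] [NormedSpace ℂ E]

/-- `P` is a predual of the bimodule `E`: a closed sub-bimodule of `E^*`, where
`(a · φ)(x) = φ (x · a)` and `(φ · a)(x) = φ (a · x)`, such that `E = P^*` through the canonical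
map `x ↦ (φ ↦ φ x)`. -/
structure IsPredual (M : BanachBimodule A E) (P : Submodule ℂ (StrongDual ℂ E)) : Prop where
  isClosed : IsClosed (P : Set (StrongDual ℂ E))
  smul_mem : ∀ (a : A), ∀ φ ∈ P, φ.comp (M.ract a) ∈ P
  mem_smul : ∀ (a : A), ∀ φ ∈ P, φ.comp (M.lact a) ∈ P
  bijective : Function.Bijective
    (fun x : E => (NormedSpace.inclusionInDoubleDual ℂ E x).comp P.subtypeL)

/-- With respect to the preduals `PA` of `A` and `P` of `E`, the bimodule `E` is normal: for every
`x ∈ E` the maps `a ↦ a · x` and `a ↦ x · a` are `w*`-continuous. -/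
structure IsNormal (M : BanachBimodule A E) (PA : Submodule ℂ (StrongDual ℂ A))
    (P : Submodule ℂ (StrongDual ℂ E)) : Prop where
  left : ∀ x : E, Continuous[wstarTopology PA, wstarTopology P] (fun a : A => M.lact a x)
  right : ∀ x : E, Continuous[wstarTopology PA, wstarTopology P] (fun a : A => M.ract a x)

/-- `D` is a (bounded) derivation: `D (a b) = D a · b + a · D b`. -/
def IsDerivation (M : BanachBimodule A E) (D : A →L[ℂ] E) : Prop :=
  ∀ a b : A, D (a * b) = M.ract b (D a) + M.lact a (D b)

/-- `D` is inner. -/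
def IsInner (M : BanachBimodule A E) (D : A →L[ℂ] E) : Prop :=
  ∃ x : E, ∀ a : A, D a = M.lact a x - M.ract a x

/-- `D` is pointwise inner at `a₀`. -/
def IsInnerAt (M : BanachBimodule A E) (D : A →L[ℂ] E) (a₀ : A) : Prop :=
  ∃ x : E, D a₀ = M.lact a₀ x - M.ract a₀ x

/-- `D` is pointwise `w*`-approximately inner at `a₀`: there is a net `(x i)` in `E` with
`D a₀ = w*-lim (a₀ · x i - x i · a₀)`. -/
def IsWStarApproxInnerAt (M : BanachBimodule A E) (P : Submodule ℂ (StrongDual ℂ E))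
    (D : A →L[ℂ] E) (a₀ : A) : Prop :=
  ∃ (ι : Type v) (_ : Preorder ι) (_ : IsDirectedOrder ι) (_ : Nonempty ι) (x : ι → E),
    Tendsto (fun i => M.lact a₀ (x i) - M.ract a₀ (x i)) atTop (@nhds E (wstarTopology P) (D a₀))

end BanachBimodule

variable (A : Type u) [NonUnitalNormedRing A] [NormedSpace ℂ A]

/-- `A` is a dual Banach algebra with predual `PA`. -/
def IsDualBanachAlgebra [IsScalarTower ℂ A A] [SMulCommClass ℂ A A]
    (PA : Submodule ℂ (StrongDual ℂ A)) : Prop :=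
  CompleteSpace A ∧ (BanachBimodule.self A).IsPredual PA

/-- `A = (PA)^*` is Connes amenable. -/
def ConnesAmenable (PA : Submodule ℂ (StrongDual ℂ A)) : Prop :=
  ∀ (E : Type v) [NormedAddCommGroup E] [NormedSpace ℂ E] [CompleteSpace E]
    (M : BanachBimodule A E) (P : Submodule ℂ (StrongDual ℂ E)),
    M.IsPredual P → M.IsNormal PA P →
    ∀ D : A →L[ℂ] E, M.IsDerivation D →
      Continuous[wstarTopology PA, wstarTopology P] D → M.IsInner D

/-- `A = (PA)^*` is pointwise Connes amenable at `a₀`. -/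
def PointwiseConnesAmenableAt (PA : Submodule ℂ (StrongDual ℂ A)) (a₀ : A) : Prop :=
  ∀ (E : Type v) [NormedAddCommGroup E] [NormedSpace ℂ E] [CompleteSpace E]
    (M : BanachBimodule A E) (P : Submodule ℂ (StrongDual ℂ E)),
    M.IsPredual P → M.IsNormal PA P →
    ∀ D : A →L[ℂ] E, M.IsDerivation D →
      Continuous[wstarTopology PA, wstarTopology P] D → M.IsInnerAt D a₀

/-- `A = (PA)^*` is pointwise `w*`-approximately Connes amenable at `a₀`. -/
def PointwiseWStarApproxConnesAmenableAt (PA : Submodule ℂ (StrongDual ℂ A)) (a₀ : A) : Prop :=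
  ∀ (E : Type v) [NormedAddCommGroup E] [NormedSpace ℂ E] [CompleteSpace E]
    (M : BanachBimodule A E) (P : Submodule ℂ (StrongDual ℂ E)),
    M.IsPredual P → M.IsNormal PA P →
    ∀ D : A →L[ℂ] E, M.IsDerivation D →
      Continuous[wstarTopology PA, wstarTopology P] D → M.IsWStarApproxInnerAt P D a₀

/-- `A = (PA)^*` is pointwise Connes amenable. -/
def PointwiseConnesAmenable (PA : Submodule ℂ (StrongDual ℂ A)) : Prop :=
  ∀ a₀ : A, PointwiseConnesAmenableAt.{u, v} A PA a₀

/-- `A = (PA)^*` is pointwise `w*`-approximately Connes amenable. -/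
def PointwiseWStarApproxConnesAmenable (PA : Submodule ℂ (StrongDual ℂ A)) : Prop :=
  ∀ a₀ : A, PointwiseWStarApproxConnesAmenableAt.{u, v} A PA a₀

end General

/-! ## The weighted semigroup algebra `ℓ¹(ℕ_∧, ω)` -/

/-- The space of all `f : ℕ → ℂ` with `∑ |f n| ω n < ∞`. -/
noncomputable def ellOneSubmodule (ω : ℕ → Set.Ici (1 : ℝ)) : Submodule ℂ (ℕ → ℂ) where
  carrier := {f | Summable fun n => ‖f n‖ * (ω n : ℝ)}
  zero_mem' := by simp
  add_mem' {f g} hf hg := by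
    refine Summable.of_nonneg_of_le (fun n => ?_) (fun n => ?_) (Summable.add hf hg)
    · exact mul_nonneg (norm_nonneg _) (zero_le_one.trans (ω n).2)
    · rw [← add_mul]
      exact mul_le_mul_of_nonneg_right (norm_add_le _ _) (zero_le_one.trans (ω n).2)
  smul_mem' c f hf := by
    simpa [mul_assoc] using Summable.mul_left ‖c‖ hf

/-- The underlying space of `ℓ¹(ℕ_∧, ω)`. -/
def EllOneMin (ω : ℕ → Set.Ici (1 : ℝ)) : Type := ellOneSubmodule ω

namespace EllOneMin

variable {ω : ℕ → Set.Ici (1 : ℝ)}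

noncomputable instance : AddCommGroup (EllOneMin ω) :=
  inferInstanceAs (AddCommGroup (ellOneSubmodule ω))

noncomputable instance : Module ℂ (EllOneMin ω) := inferInstanceAs (Module ℂ (ellOneSubmodule ω))

instance : FunLike (EllOneMin ω) ℕ ℂ where
  coe f := Subtype.val (p := fun x => x ∈ ellOneSubmodule ω) f
  coe_injective _ _ h := Subtype.ext h

/-- The element of `ℓ¹(ℕ_∧, ω)` given by a function `f` with `∑ |f n| ω n < ∞`. -/
def mk (f : ℕ → ℂ) (hf : Summable fun n => ‖f n‖ * (ω n : ℝ)) : EllOneMin ω :=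
  (⟨f, hf⟩ : ellOneSubmodule ω)

@[simp] theorem mk_apply (f : ℕ → ℂ) (hf : Summable fun n => ‖f n‖ * (ω n : ℝ)) (n : ℕ) :
    mk f hf n = f n := rfl

@[ext] theorem ext {f g : EllOneMin ω} (h : ∀ n, f n = g n) : f = g := DFunLike.ext f g h

@[simp] theorem zero_apply (n : ℕ) : (0 : EllOneMin ω) n = 0 := rfl
@[simp] theorem add_apply (f g : EllOneMin ω) (n : ℕ) : (f + g) n = f n + g n := rfl
@[simp] theorem smul_apply (c : ℂ) (f : EllOneMin ω) (n : ℕ) : (c • f) n = c * f n := rfl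

theorem one_le (ω : ℕ → Set.Ici (1 : ℝ)) (n : ℕ) : (1 : ℝ) ≤ ω n := (ω n).2
theorem pos (ω : ℕ → Set.Ici (1 : ℝ)) (n : ℕ) : (0 : ℝ) < ω n := zero_lt_one.trans_le (one_le ω n)

theorem summable_weight (f : EllOneMin ω) : Summable fun n => ‖f n‖ * (ω n : ℝ) := f.2

theorem summable_norm (f : EllOneMin ω) : Summable fun n => ‖f n‖ :=
  Summable.of_nonneg_of_le (fun _ => norm_nonneg _)
    (fun n => le_mul_of_one_le_right (norm_nonneg _) (one_le ω n)) f.summable_weight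

/-- The norm `‖f‖ = ∑ |f n| ω n`. -/
noncomputable instance : Norm (EllOneMin ω) := ⟨fun f => ∑' n, ‖f n‖ * (ω n : ℝ)⟩

theorem norm_def (f : EllOneMin ω) : ‖f‖ = ∑' n, ‖f n‖ * (ω n : ℝ) := rfl

theorem term_nonneg (f : EllOneMin ω) (n : ℕ) : 0 ≤ ‖f n‖ * (ω n : ℝ) :=
  mul_nonneg (norm_nonneg _) (pos ω n).le

theorem normCore (ω : ℕ → Set.Ici (1 : ℝ)) : NormedSpace.Core ℂ (EllOneMin ω) where
  norm_nonneg f := tsum_nonneg f.term_nonneg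
  norm_smul c f := by
    simp only [norm_def, smul_apply, norm_mul, mul_assoc, tsum_mul_left]
  norm_triangle f g := by
    rw [norm_def, norm_def, norm_def, ← f.summable_weight.tsum_add g.summable_weight]
    refine (f + g).summable_weight.tsum_le_tsum (fun n => ?_)
      (f.summable_weight.add g.summable_weight)
    rw [← add_mul]
    exact mul_le_mul_of_nonneg_right (norm_add_le _ _) (pos ω n).le
  norm_eq_zero_iff f := by
    rw [norm_def, ← f.summable_weight.hasSum_iff, hasSum_zero_iff_of_nonneg f.term_nonneg]
    constructor
    · intro h
      ext n
      have := congrFun h n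
      simpa [(pos ω n).ne'] using this
    · rintro rfl
      ext n
      simp

noncomputable instance instNormedAddCommGroup : NormedAddCommGroup (EllOneMin ω) :=
  NormedAddCommGroup.ofCore (normCore ω)

noncomputable instance instNormedSpace : NormedSpace ℂ (EllOneMin ω) :=
  NormedSpace.ofCore (normCore ω)

theorem summable_prod (f g : EllOneMin ω) :
    Summable fun p : ℕ × ℕ => ‖f p.1 * g p.2‖ := by
  simpa using f.summable_norm.mul_of_nonneg g.summable_norm
    (fun _ => norm_nonneg _) (fun _ => norm_nonneg _)

/-- The convolution of two functions over the semigroup `(ℕ, min)`: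
`(f ⋆ g)(k) = ∑_{min m n = k} f m * g n`. -/
noncomputable def conv (f g : ℕ → ℂ) (k : ℕ) : ℂ :=
  ∑' p : ℕ × ℕ, if min p.1 p.2 = k then f p.1 * g p.2 else 0

theorem hasSum_fiber {V : Type*} [NormedAddCommGroup V] [CompleteSpace V] {u : ℕ × ℕ → V}
    (hu : Summable u) :
    HasSum (fun k => ∑' p : ℕ × ℕ, if min p.1 p.2 = k then u p else 0) (∑' p, u p) := by
  have hinj : Function.Injective (fun p : ℕ × ℕ => (min p.1 p.2, p)) := fun p q h =>
    (Prod.mk.inj h).2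
  have h0 : ∀ x ∉ Set.range (fun p : ℕ × ℕ => (min p.1 p.2, p)),
      (fun x : ℕ × (ℕ × ℕ) => if min x.2.1 x.2.2 = x.1 then u x.2 else 0) x = 0 := by
    rintro ⟨k, p⟩ hx
    refine if_neg fun h => hx ⟨p, ?_⟩
    simp only at h
    simp [h]
  have hF : HasSum (fun x : ℕ × (ℕ × ℕ) => if min x.2.1 x.2.2 = x.1 then u x.2 else 0)
      (∑' p, u p) := by
    rw [← hinj.hasSum_iff h0]
    simpa [Function.comp_def] using hu.hasSum
  exact hF.prod_fiberwise fun k => (hF.summable.prod_factor k).hasSum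

theorem summable_prod_weight (f g : EllOneMin ω) :
    Summable fun p : ℕ × ℕ => (‖f p.1‖ * (ω p.1 : ℝ)) * (‖g p.2‖ * (ω p.2 : ℝ)) :=
  f.summable_weight.mul_of_nonneg g.summable_weight f.term_nonneg g.term_nonneg

theorem norm_conv_le (f g : EllOneMin ω) (k : ℕ) :
    ‖conv f g k‖ * (ω k : ℝ) ≤ ∑' p : ℕ × ℕ, if min p.1 p.2 = k then
      (‖f p.1‖ * (ω p.1 : ℝ)) * (‖g p.2‖ * (ω p.2 : ℝ)) else 0 := by
  have h1 : Summable fun p : ℕ × ℕ => ‖if min p.1 p.2 = k then f p.1 * g p.2 else 0‖ := by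
    refine Summable.of_nonneg_of_le (fun _ => norm_nonneg _) (fun p => ?_) (summable_prod f g)
    split_ifs <;> simp
    positivity
  have h2 : Summable fun p : ℕ × ℕ => if min p.1 p.2 = k then
      (‖f p.1‖ * (ω p.1 : ℝ)) * (‖g p.2‖ * (ω p.2 : ℝ)) else 0 := by
    refine Summable.of_nonneg_of_le (fun p => ?_) (fun p => ?_) (summable_prod_weight f g)
    · split_ifs
      · exact mul_nonneg (f.term_nonneg _) (g.term_nonneg _)
      · exact le_rfl
    · split_ifs
      · exact le_rfl
      · exact mul_nonneg (f.term_nonneg _) (g.term_nonneg _)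
  refine (mul_le_mul_of_nonneg_right (norm_tsum_le_tsum_norm h1) (pos ω k).le).trans ?_
  rw [← tsum_mul_right]
  refine (h1.mul_right _).tsum_le_tsum (fun p => ?_) h2
  split_ifs with h
  · have hk : (ω k : ℝ) ≤ (ω p.1 : ℝ) * (ω p.2 : ℝ) := by
      have a1 := one_le ω p.1
      have a2 := one_le ω p.2
      rcases min_choice p.1 p.2 with h' | h' <;> rw [h'] at h <;> rw [← h] <;> nlinarith
    rw [norm_mul]
    calc ‖f p.1‖ * ‖g p.2‖ * (ω k : ℝ)
        ≤ ‖f p.1‖ * ‖g p.2‖ * ((ω p.1 : ℝ) * (ω p.2 : ℝ)) := by gcongr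
      _ = _ := by ring
  · simp

theorem summable_conv (f g : EllOneMin ω) : Summable fun k => ‖conv f g k‖ * (ω k : ℝ) :=
  Summable.of_nonneg_of_le (fun k => mul_nonneg (norm_nonneg _) (pos ω k).le)
    (norm_conv_le f g) (hasSum_fiber (summable_prod_weight f g)).summable

/-- The product of `ℓ¹(ℕ_∧, ω)` is convolution. -/
noncomputable instance : Mul (EllOneMin ω) := ⟨fun f g => mk (conv f g) (summable_conv f g)⟩

theorem mul_apply (f g : EllOneMin ω) (k : ℕ) :
    (f * g) k = ∑' p : ℕ × ℕ, if min p.1 p.2 = k then f p.1 * g p.2 else 0 := rfl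

theorem norm_mul_le' (f g : EllOneMin ω) : ‖f * g‖ ≤ ‖f‖ * ‖g‖ := by
  have h := hasSum_fiber (summable_prod_weight f g)
  calc ‖f * g‖ ≤ ∑' p : ℕ × ℕ, (‖f p.1‖ * (ω p.1 : ℝ)) * (‖g p.2‖ * (ω p.2 : ℝ)) := by
        rw [← h.tsum_eq]
        exact (summable_conv f g).tsum_le_tsum (norm_conv_le f g) h.summable
    _ = ‖f‖ * ‖g‖ := (f.summable_weight.tsum_mul_tsum g.summable_weight
        (summable_prod_weight f g)).symm

/-- The tail sums `∑_{k ≥ n} f k`; these are multiplicative in `f` and determine `f`. -/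
noncomputable def tail (n : ℕ) (f : EllOneMin ω) : ℂ := ∑' k, if n ≤ k then f k else 0

theorem summable_tail_norm (n : ℕ) (f : EllOneMin ω) :
    Summable fun k => ‖if n ≤ k then f k else 0‖ := by
  refine Summable.of_nonneg_of_le (fun _ => norm_nonneg _) (fun k => ?_) f.summable_norm
  split_ifs <;> simp

theorem tail_mul (n : ℕ) (f g : EllOneMin ω) : tail n (f * g) = tail n f * tail n g := by
  have hu : Summable fun p : ℕ × ℕ => (if n ≤ p.1 then f p.1 else 0) *
      (if n ≤ p.2 then g p.2 else 0) :=
    summable_mul_of_summable_norm (f := fun k => if n ≤ k then f k else 0)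
      (g := fun k => if n ≤ k then g k else 0) (summable_tail_norm n f) (summable_tail_norm n g)
  rw [tail, tail, tail, tsum_mul_tsum_of_summable_norm (summable_tail_norm n f)
    (summable_tail_norm n g), ← (hasSum_fiber hu).tsum_eq]
  refine tsum_congr fun k => ?_
  rw [mul_apply]
  by_cases hk : n ≤ k
  · rw [if_pos hk]
    refine tsum_congr fun p => ?_
    by_cases hp : min p.1 p.2 = k
    · rw [if_pos hp, if_pos hp, if_pos (by omega), if_pos (by omega)]
    · rw [if_neg hp, if_neg hp]
  · rw [if_neg hk, eq_comm]
    refine Eq.trans (tsum_congr fun p => ?_) (tsum_zero (β := ℕ × ℕ))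
    by_cases hp : min p.1 p.2 = k
    · rw [if_pos hp]
      by_cases h1 : n ≤ p.1
      · rw [if_neg (show ¬ n ≤ p.2 by omega), mul_zero]
      · rw [if_neg h1, zero_mul]
    · rw [if_neg hp]

theorem tail_add (n : ℕ) (f g : EllOneMin ω) : tail n (f + g) = tail n f + tail n g := by
  rw [tail, tail, tail, ← (summable_tail_norm n f).of_norm.tsum_add (summable_tail_norm n g).of_norm]
  refine tsum_congr fun k => ?_
  split_ifs <;> simp

theorem tail_smul (n : ℕ) (c : ℂ) (f : EllOneMin ω) : tail n (c • f) = c * tail n f := by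
  rw [tail, tail, ← tsum_mul_left]
  refine tsum_congr fun k => ?_
  split_ifs <;> simp

theorem tail_zero (n : ℕ) : tail n (0 : EllOneMin ω) = 0 := by simp [tail]

theorem apply_eq_tail_sub (f : EllOneMin ω) (n : ℕ) : f n = tail n f - tail (n + 1) f := by
  rw [tail, tail, ← (summable_tail_norm n f).of_norm.tsum_sub
    (summable_tail_norm (n + 1) f).of_norm, tsum_eq_single n]
  · simp
  · intro k hk
    split_ifs <;> first | omega | simp

theorem eq_of_tail {f g : EllOneMin ω} (h : ∀ n, tail n f = tail n g) : f = g := by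
  ext n
  rw [apply_eq_tail_sub, apply_eq_tail_sub g, h, h]

noncomputable instance instNonUnitalNormedRing : NonUnitalNormedRing (EllOneMin ω) where
  __ := instNormedAddCommGroup
  mul := (· * ·)
  left_distrib f g h := eq_of_tail fun n => by simp only [tail_mul, tail_add]; ring
  right_distrib f g h := eq_of_tail fun n => by simp only [tail_mul, tail_add]; ring
  zero_mul f := eq_of_tail fun n => by simp only [tail_mul, tail_zero]; ring
  mul_zero f := eq_of_tail fun n => by simp only [tail_mul, tail_zero]; ring
  mul_assoc f g h := eq_of_tail fun n => by simp only [tail_mul]; ring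
  norm_mul_le := norm_mul_le'

instance : IsScalarTower ℂ (EllOneMin ω) (EllOneMin ω) where
  smul_assoc c f g := eq_of_tail fun n => by
    simp only [smul_eq_mul, tail_mul, tail_smul]; ring

instance : SMulCommClass ℂ (EllOneMin ω) (EllOneMin ω) where
  smul_comm c f g := eq_of_tail fun n => by
    simp only [smul_eq_mul, tail_mul, tail_smul]; ring

/-- If `F n / ω n → 0`, then `∑ F n * f n` converges absolutely for `f ∈ ℓ¹(ω)`. -/
theorem summable_pairing {F : ℕ → ℂ}
    (hF : Tendsto (fun n => ‖F n‖ / (ω n : ℝ)) atTop (𝓝 0)) (f : EllOneMin ω) :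
    Summable fun n => F n * f n := by
  obtain ⟨C, hC⟩ := hF.bddAbove_range
  refine Summable.of_norm_bounded (f.summable_weight.mul_left C) fun n => ?_
  have h1 : ‖F n‖ ≤ C * (ω n : ℝ) := (div_le_iff₀ (pos ω n)).1 (hC ⟨n, rfl⟩)
  rw [norm_mul]
  calc ‖F n‖ * ‖f n‖ ≤ C * (ω n : ℝ) * ‖f n‖ := by gcongr
    _ = _ := by ring

/-- The predual `c₀(ω⁻¹)`, as a space of functionals on `ℓ¹(ℕ_∧, ω)`: the functionals
`f ↦ ∑ F n * f n` with `F n / ω n → 0`. -/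
noncomputable def predual (ω : ℕ → Set.Ici (1 : ℝ)) :
    Submodule ℂ (StrongDual ℂ (EllOneMin ω)) where
  carrier := {φ | ∃ F : ℕ → ℂ, Tendsto (fun n => ‖F n‖ / (ω n : ℝ)) atTop (𝓝 0) ∧
    ∀ f : EllOneMin ω, φ f = ∑' n, F n * f n}
  zero_mem' := ⟨0, by simp, by simp⟩
  add_mem' := by
    rintro φ ψ ⟨F, hF, hφ⟩ ⟨G, hG, hψ⟩
    refine ⟨F + G, ?_, fun f => ?_⟩
    · refine squeeze_zero (fun n => div_nonneg (norm_nonneg _) (pos ω n).le) (fun n => ?_)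
        (by simpa using hF.add hG)
      rw [← add_div]
      exact div_le_div_of_nonneg_right (norm_add_le _ _) (pos ω n).le
    · rw [_root_.add_apply, hφ, hψ,
        ← (summable_pairing hF f).tsum_add (summable_pairing hG f)]
      exact tsum_congr fun n => by simp [add_mul]
  smul_mem' := by
    rintro c φ ⟨F, hF, hφ⟩
    refine ⟨c • F, ?_, fun f => ?_⟩
    · simpa [mul_div_assoc] using hF.const_mul ‖c‖
    · simp [hφ, mul_assoc, tsum_mul_left]

end EllOneMin

/-!
# Connes amenability of `ℓ¹(ℕ_∧, ω)`

The characters `tail n f = ∑_{k ≥ n} f k` are multiplicative and separate points. They identify the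
algebra with the null sequences `s` such that `∑ |s n - s (n + 1)| ω n < ∞`, under pointwise
multiplication (`EllOneMin.exists_tail_eq`).

*Duality.* A bounded functional `φ` belongs to `c₀(ω⁻¹)` iff `φ (δ n) / ω n → 0`, which gives
closedness and the duality `c₀(ω⁻¹)^* = ℓ¹(ω)`. Translates of functionals lie in the predual because
`δ m * δ n = δ m` for `n ≥ m` while `ω n → ∞`.

*Failure of exact innerness.* On the bimodule `A` with zero right action the identity is a
`w*`-continuous derivation, and it is inner at `a` only if `a = a x` for some `x ∈ A`. If no tail of
`a` vanishes, then all tails of `x` equal `1`, which is impossible since tails tend to `0`. Pointwise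
Connes amenability fails, and with it Connes amenability.

*Approximate innerness.* For each spectral value `c ≠ 0` of `a` the indicator of
`{n | tail n a = c}` is the tail sequence of an idempotent `p` with `a p = c p`, and `c` is not in the
spectrum of `a - a p`. Splitting `D p = p · D p + D p · p`, the operator `x ↦ a · x - x · a` can be
inverted at each summand, so `D p = a · x - x · a` for some `x`
(`BanachBimodule.IsDerivation.mem_adRange_of_isIdempotentElem`). Hence the same holds for `D b`
whenever `b` is a finite combination of such idempotents, and truncating the tails of `a` near `0`
by uniformly Lipschitz functions gives such `b` converging to `a` in norm. So the derivation is even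
approximated in norm, by a sequence.
-/

/-! ### Point masses, coordinates and tails -/

theorem exists_bound_of_norm_le_one {F : Type*} [NormedAddCommGroup F] [NormedSpace ℂ F]
    (P : Submodule ℂ F) (ψ : P →L[ℂ] ℂ) : ∃ C, ∀ y : P, ‖y‖ ≤ 1 → ‖ψ y‖ ≤ C :=
  ⟨‖ψ‖, fun y hy => ψ.unit_le_opNorm y hy⟩

namespace EllOneMin

variable {ω : ℕ → Set.Ici (1 : ℝ)}

theorem norm_apply_mul_le (f : EllOneMin ω) (n : ℕ) : ‖f n‖ * (ω n : ℝ) ≤ ‖f‖ :=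
  f.summable_weight.le_tsum n fun k _ => f.term_nonneg k

theorem norm_apply_le (f : EllOneMin ω) (n : ℕ) : ‖f n‖ ≤ ‖f‖ :=
  (le_mul_of_one_le_right (norm_nonneg _) (one_le ω n)).trans (norm_apply_mul_le f n)

protected theorem mul_comm (f g : EllOneMin ω) : f * g = g * f :=
  eq_of_tail fun n => by rw [tail_mul, tail_mul, _root_.mul_comm]

/-- The isometric isomorphism `f ↦ f · ω` of `ℓ¹(ω)` onto the unweighted `ℓ¹`. -/
noncomputable def toLp (ω : ℕ → Set.Ici (1 : ℝ)) :
    EllOneMin ω ≃ₗᵢ[ℂ] lp (fun _ : ℕ => ℂ) 1 where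
  toFun f := ⟨fun n => f n * ((ω n : ℝ) : ℂ), by
    refine (memℓp_gen_iff (by simp)).2 ?_
    simpa [abs_of_pos (pos ω _)] using f.summable_weight⟩
  invFun g := mk (fun n => g n / ((ω n : ℝ) : ℂ)) <| by
    have h := (memℓp_gen_iff (p := 1) (by simp)).1 g.2
    simpa [abs_of_pos (pos ω _), (pos ω _).ne'] using h
  map_add' f g := by ext n; exact add_mul _ _ _
  map_smul' c f := by ext n; simp [mul_assoc]
  left_inv f := by
    ext n
    have := (pos ω n).ne'
    simp [this]
  right_inv g := by
    ext n
    have := (pos ω n).ne'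
    simp [this]
  norm_map' f := by
    rw [lp.norm_eq_tsum_rpow (by simp)]
    simp [abs_of_pos (pos ω _), norm_def]

instance : CompleteSpace (EllOneMin ω) :=
  (completeSpace_congr (e := (toLp ω).toLinearEquiv.toEquiv) (toLp ω).isometry.isUniformEmbedding).2
    inferInstance

/-- The point mass `δ n`. -/
noncomputable def delta (ω : ℕ → Set.Ici (1 : ℝ)) (n : ℕ) : EllOneMin ω :=
  mk (Pi.single n 1) <| summable_of_ne_finset_zero (s := {n}) fun k hk => by
    simp [Finset.notMem_singleton.1 hk]

theorem delta_apply (n k : ℕ) : delta ω n k = if k = n then 1 else 0 := by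
  simp [delta, Pi.single_apply]

theorem norm_delta (n : ℕ) : ‖delta ω n‖ = ω n := by
  rw [norm_def, tsum_eq_single n fun k hk => by simp [delta_apply, hk]]
  simp [delta_apply]

theorem tail_delta (n k : ℕ) : tail k (delta ω n) = if k ≤ n then 1 else 0 := by
  rw [tail, tsum_eq_single n fun j hj => by simp [delta_apply, hj]]
  simp [delta_apply]

theorem delta_mul_delta (m n : ℕ) : delta ω m * delta ω n = delta ω (min m n) := by
  refine eq_of_tail fun k => ?_
  simp only [tail_mul, tail_delta, le_min_iff]
  by_cases h1 : k ≤ m <;> by_cases h2 : k ≤ n <;> simp [h1, h2]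

/-- The coordinate functional `f ↦ f n`. -/
noncomputable def coord (ω : ℕ → Set.Ici (1 : ℝ)) (n : ℕ) : StrongDual ℂ (EllOneMin ω) :=
  LinearMap.mkContinuous
    { toFun := fun f => f n, map_add' := fun _ _ => rfl, map_smul' := fun _ _ => rfl } 1
    fun f => (norm_apply_le f n).trans_eq (one_mul _).symm

@[simp] theorem coord_apply (n : ℕ) (f : EllOneMin ω) : coord ω n f = f n := rfl

theorem hasSum_delta (f : EllOneMin ω) : HasSum (fun n => f n • delta ω n) f := by
  have hs : Summable fun n => f n • delta ω n :=
    .of_norm (by simpa [norm_smul, norm_delta] using f.summable_weight)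
  convert hs.hasSum
  ext n
  have h := hs.hasSum.mapL (coord ω n)
  refine (hasSum_single n fun k hk => ?_).unique h |>.symm ▸ ?_
  · simp [delta_apply, Ne.symm hk]
  · simp [delta_apply]

theorem tendsto_tail (f : EllOneMin ω) : Tendsto (fun n => tail n f) atTop (𝓝 0) := by
  have h0 : ∀ n, tail n f = tail 0 f - ∑ k ∈ Finset.range n, f k := fun n => by
    induction n with
    | zero => simp
    | succ n ih => rw [Finset.sum_range_succ, ← sub_sub, ← ih, apply_eq_tail_sub]; ring
  have h1 : tail 0 f = ∑' k, f k := by simp [tail]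
  have h2 := f.summable_norm.of_norm.hasSum.tendsto_sum_nat.const_sub (tail 0 f)
  rw [h1, sub_self] at h2
  exact h2.congr fun n => by rw [h0, h1]

/-- Tail sequences `n ↦ tail n f` of elements of `ℓ¹(ω)` are exactly the null sequences whose
variation, weighted by `ω`, is finite. Since `tail n` is multiplicative, this identifies the algebra
with an algebra of sequences under pointwise operations. -/
theorem exists_tail_eq {s : ℕ → ℂ} (h0 : Tendsto s atTop (𝓝 0))
    (hs : Summable fun n => ‖s n - s (n + 1)‖ * (ω n : ℝ)) :
    ∃ f : EllOneMin ω, ∀ n, tail n f = s n := by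
  refine ⟨mk _ hs, fun n => ?_⟩
  set f : EllOneMin ω := mk _ hs with hf
  have hstep : ∀ n, tail n f - s n = tail (n + 1) f - s (n + 1) := fun n => by
    have h : s n - s (n + 1) = tail n f - tail (n + 1) f := apply_eq_tail_sub f n
    linear_combination -h
  have hconst : ∀ m, tail (m + n) f - s (m + n) = tail n f - s n := fun m => by
    induction m with
    | zero => simp
    | succ m ih => rw [add_right_comm, ← hstep, ih]
  have hlim := (((tendsto_tail f).sub h0).comp (tendsto_add_atTop_nat n)).congr hconst
  rw [sub_self] at hlim
  exact sub_eq_zero.1 (tendsto_nhds_unique tendsto_const_nhds hlim)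

theorem norm_eq_tsum_tail (f : EllOneMin ω) :
    ‖f‖ = ∑' n, ‖tail n f - tail (n + 1) f‖ * (ω n : ℝ) := by
  simp only [norm_def, apply_eq_tail_sub]

theorem summable_tail (f : EllOneMin ω) :
    Summable fun n => ‖tail n f - tail (n + 1) f‖ * (ω n : ℝ) := by
  simpa only [apply_eq_tail_sub] using f.summable_weight

/-! ### The predual `c₀(ω⁻¹)` -/

theorem mem_predual_iff {φ : StrongDual ℂ (EllOneMin ω)} :
    φ ∈ predual ω ↔ Tendsto (fun n => ‖φ (delta ω n)‖ / (ω n : ℝ)) atTop (𝓝 0) := by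
  constructor
  · rintro ⟨F, hF, hφ⟩
    refine hF.congr fun n => ?_
    rw [hφ, tsum_eq_single n fun k hk => by simp [delta_apply, hk]]
    simp [delta_apply]
  · refine fun h => ⟨fun n => φ (delta ω n), h, fun f => ?_⟩
    rw [← ((hasSum_delta f).mapL φ).tsum_eq]
    exact tsum_congr fun n => by simp [_root_.mul_comm]

theorem norm_apply_delta_div_le (φ : StrongDual ℂ (EllOneMin ω)) (n : ℕ) :
    ‖φ (delta ω n)‖ / (ω n : ℝ) ≤ ‖φ‖ :=
  (div_le_iff₀ (pos ω n)).2 (by simpa [norm_delta] using φ.le_opNorm (delta ω n))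

theorem opNorm_le_of_delta {φ : StrongDual ℂ (EllOneMin ω)} {C : ℝ} (hC : 0 ≤ C)
    (h : ∀ n, ‖φ (delta ω n)‖ ≤ C * (ω n : ℝ)) : ‖φ‖ ≤ C := by
  refine φ.opNorm_le_bound hC fun f => ?_
  rw [← ((hasSum_delta f).mapL φ).tsum_eq, norm_def, ← tsum_mul_left]
  refine tsum_of_norm_bounded (f.summable_weight.mul_left C).hasSum fun n => ?_
  rw [map_smul, norm_smul]
  calc ‖f n‖ * ‖φ (delta ω n)‖ ≤ ‖f n‖ * (C * (ω n : ℝ)) := by gcongr; exact h n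
    _ = _ := by ring

theorem isClosed_predual (ω : ℕ → Set.Ici (1 : ℝ)) :
    IsClosed (predual ω : Set (StrongDual ℂ (EllOneMin ω))) := by
  refine isClosed_of_closure_subset fun φ hφ => ?_
  refine mem_predual_iff.2 (Metric.tendsto_atTop.2 fun ε hε => ?_)
  obtain ⟨ψ, hψ, hd⟩ := Metric.mem_closure_iff.1 hφ (ε / 2) (half_pos hε)
  obtain ⟨N, hN⟩ := Metric.tendsto_atTop.1 (mem_predual_iff.1 hψ) (ε / 2) (half_pos hε)
  refine ⟨N, fun n hn => ?_⟩
  have h1 := hN n hn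
  have h2 := norm_apply_delta_div_le (φ - ψ) n
  rw [dist_eq_norm] at hd
  rw [Real.dist_eq, sub_zero, abs_of_nonneg (div_nonneg (norm_nonneg _) (pos ω n).le)] at h1 ⊢
  have h3 : ‖φ (delta ω n)‖ ≤ ‖(φ - ψ) (delta ω n)‖ + ‖ψ (delta ω n)‖ := by
    simpa using norm_add_le ((φ - ψ) (delta ω n)) (ψ (delta ω n))
  have h4 := div_le_div_of_nonneg_right h3 (pos ω n).le
  rw [add_div] at h4
  linarith

/-- For every bounded functional `φ`, not only for those in the predual, `φ (a * ·)` lies in the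
predual: as `n ≥ m` grows, `φ (δ m * δ n) = φ (δ m)` is constant while `ω n → ∞`. -/
theorem comp_mul_mem_predual (hω : Tendsto (fun n => (ω n : ℝ)) atTop atTop)
    (φ : StrongDual ℂ (EllOneMin ω)) (a : EllOneMin ω) :
    φ.comp (ContinuousLinearMap.mul ℂ (EllOneMin ω) a) ∈ predual ω := by
  have h := (hasSum_delta a).mapL ((ContinuousLinearMap.compL ℂ (EllOneMin ω) (EllOneMin ω) ℂ φ).comp
    (ContinuousLinearMap.mul ℂ (EllOneMin ω)))
  refine (isClosed_predual ω).mem_of_tendsto h (.of_forall fun s =>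
    Submodule.sum_mem _ fun m _ => ?_)
  rw [map_smul]
  refine Submodule.smul_mem _ _ (mem_predual_iff.2 ?_)
  refine (tendsto_const_nhds (x := ‖φ (delta ω m)‖)).div_atTop hω |>.congr' ?_
  filter_upwards [eventually_ge_atTop m] with n hn
  simp [delta_mul_delta, hn]

theorem coord_mem_predual (n : ℕ) : coord ω n ∈ predual ω := by
  refine mem_predual_iff.2 (tendsto_const_nhds.congr' ?_)
  filter_upwards [eventually_gt_atTop n] with k hk
  simp [delta_apply, hk.ne]

theorem tendsto_sum_coord {φ : StrongDual ℂ (EllOneMin ω)} (hφ : φ ∈ predual ω) :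
    Tendsto (fun N => ∑ n ∈ Finset.range N, φ (delta ω n) • coord ω n) atTop (𝓝 φ) := by
  refine Metric.tendsto_atTop.2 fun ε hε => ?_
  obtain ⟨N, hN⟩ := Metric.tendsto_atTop.1 (mem_predual_iff.1 hφ) (ε / 2) (half_pos hε)
  refine ⟨N, fun M hM => ?_⟩
  rw [dist_eq_norm']
  refine lt_of_le_of_lt (opNorm_le_of_delta (half_pos hε).le fun n => ?_) (half_lt_self hε)
  by_cases hn : n < M
  · simp [delta_apply, Finset.sum_ite_eq', hn, (mul_pos (half_pos hε) (pos ω n)).le]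
  · have h1 := hN n (by omega)
    rw [Real.dist_eq, sub_zero, abs_of_nonneg (div_nonneg (norm_nonneg _) (pos ω n).le)] at h1
    simpa [delta_apply, Finset.sum_ite_eq', hn] using ((div_lt_iff₀ (pos ω n)).1 h1).le

theorem bijective_predual (ω : ℕ → Set.Ici (1 : ℝ)) : Function.Bijective
    (fun x : EllOneMin ω =>
      (NormedSpace.inclusionInDoubleDual ℂ (EllOneMin ω) x).comp (predual ω).subtypeL) := by
  constructor
  · intro f g h
    ext n
    simpa using DFunLike.congr_fun h (⟨coord ω n, coord_mem_predual n⟩ : predual ω)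
  · intro ψ
    -- The preimage of `ψ` has coordinates `ψ (e n)`; testing `ψ` on finite sums of the `e n` with
    -- phases and weights shows that it has finite weighted norm.
    set e : ℕ → predual ω := fun n => ⟨coord ω n, coord_mem_predual n⟩ with he
    obtain ⟨C, hC⟩ : ∃ C, ∀ y : predual ω, ‖y‖ ≤ 1 → ‖ψ y‖ ≤ C := by
      exact exists_bound_of_norm_le_one (predual ω) ψ
    have hsum : Summable fun n => ‖ψ (e n)‖ * (ω n : ℝ) := by
      refine summable_of_sum_le (fun n => mul_nonneg (norm_nonneg _) (pos ω n).le)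
        (c := C) fun s => ?_
      choose c hc1 hc using fun n => RCLike.exists_norm_eq_mul_self (ψ (e n))
      set y : predual ω := ∑ n ∈ s, (c n * ((ω n : ℝ) : ℂ)) • e n with hy
      have hy1 : ‖y‖ ≤ 1 := by
        refine opNorm_le_of_delta zero_le_one fun n => ?_
        have : (y : StrongDual ℂ (EllOneMin ω)) (delta ω n) =
            if n ∈ s then c n * ((ω n : ℝ) : ℂ) else 0 := by
          simp [hy, he, delta_apply, Finset.sum_ite_eq']
        change ‖(y : StrongDual ℂ (EllOneMin ω)) (delta ω n)‖ ≤ _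
        rw [this]
        split_ifs
        · simp [hc1, abs_of_pos (pos ω n)]
        · simpa using (pos ω n).le
      have hy2 : ψ y = ((∑ n ∈ s, ‖ψ (e n)‖ * (ω n : ℝ) : ℝ) : ℂ) := by
        simp only [hy, map_sum, map_smul, smul_eq_mul]
        push_cast
        refine Finset.sum_congr rfl fun n _ => ?_
        have := hc n
        simp only [Complex.coe_algebraMap] at this
        rw [this]; ring
      have h3 := hC y hy1
      rw [hy2, Complex.norm_real, Real.norm_eq_abs] at h3
      exact (le_abs_self _).trans h3
    refine ⟨mk _ hsum, ?_⟩
    ext φ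
    obtain ⟨φ, hφ⟩ := φ
    have h1 : Tendsto (fun N => ∑ n ∈ Finset.range N, φ (delta ω n) • e n) atTop
        (𝓝 (⟨φ, hφ⟩ : predual ω)) := by
      rw [tendsto_subtype_rng]
      simpa [he] using tendsto_sum_coord hφ
    have h2 := (ψ.continuous.tendsto _).comp h1
    have h3 := ((hasSum_delta (mk _ hsum)).mapL φ).tendsto_sum_nat
    refine tendsto_nhds_unique h3 (h2.congr fun N => ?_)
    simp [_root_.mul_comm]

theorem isPredual_self (hω : Tendsto (fun n => (ω n : ℝ)) atTop atTop) :
    (BanachBimodule.self (EllOneMin ω)).IsPredual (predual ω) where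
  isClosed := isClosed_predual ω
  smul_mem a φ _ := by
    convert comp_mul_mem_predual hω φ a using 1
    ext x
    simp [BanachBimodule.self, EllOneMin.mul_comm x a]
  mem_smul a φ _ := comp_mul_mem_predual hω φ a
  bijective := bijective_predual ω

end EllOneMin

/-! ### The bimodule with zero right action -/

section LeftModule

theorem continuous_wstar_rng {X : Type*} [TopologicalSpace X] {E : Type*}
    [NormedAddCommGroup E] [NormedSpace ℂ E] {P : Submodule ℂ (StrongDual ℂ E)} {f : X → E}
    (hf : ∀ φ ∈ P, Continuous fun x => φ (f x)) : Continuous[_, wstarTopology P] f :=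
  continuous_induced_rng.2 (continuous_pi fun φ => hf φ.1 φ.2)

theorem continuous_wstar {A : Type*} [NormedAddCommGroup A] [NormedSpace ℂ A] {E : Type*}
    [NormedAddCommGroup E] [NormedSpace ℂ E] {PA : Submodule ℂ (StrongDual ℂ A)}
    {P : Submodule ℂ (StrongDual ℂ E)} (T : A →L[ℂ] E) (hT : ∀ φ ∈ P, φ.comp T ∈ PA) :
    Continuous[wstarTopology PA, wstarTopology P] T :=
  @continuous_wstar_rng _ (wstarTopology PA) _ _ _ _ _ fun φ hφ =>
    @Continuous.comp _ _ _ (wstarTopology PA) _ _ (fun x (ψ : PA) => (ψ : StrongDual ℂ A) x) _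
      (continuous_apply (⟨φ.comp T, hT φ hφ⟩ : PA)) continuous_induced_dom

/-- `ULift.up` as a continuous linear map. -/
noncomputable def upCLM (A : Type) [NormedAddCommGroup A] [NormedSpace ℂ A] :
    A →L[ℂ] ULift.{v} A :=
  (ContinuousLinearEquiv.ulift (R₁ := ℂ) (M₁ := A)).symm.toContinuousLinearMap

/-- `ULift.down` as a continuous linear map. -/
noncomputable def downCLM (A : Type) [NormedAddCommGroup A] [NormedSpace ℂ A] :
    ULift.{v} A →L[ℂ] A :=
  (ContinuousLinearEquiv.ulift (R₁ := ℂ) (M₁ := A)).toContinuousLinearMap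

@[simp] theorem upCLM_apply {A : Type} [NormedAddCommGroup A] [NormedSpace ℂ A] (a : A) :
    upCLM.{v} A a = ⟨a⟩ := rfl

@[simp] theorem downCLM_apply {A : Type} [NormedAddCommGroup A] [NormedSpace ℂ A]
    (a : ULift.{v} A) : downCLM.{v} A a = a.down := rfl

/-- The copy of `PA` in the dual of `ULift A`. -/
noncomputable def liftPredual {A : Type} [NormedAddCommGroup A] [NormedSpace ℂ A]
    (PA : Submodule ℂ (StrongDual ℂ A)) :
    Submodule ℂ (StrongDual ℂ (ULift.{v} A)) :=
  PA.comap (ContinuousLinearMap.precomp ℂ (upCLM.{v} A)).toLinearMap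

theorem mem_liftPredual {A : Type} [NormedAddCommGroup A] [NormedSpace ℂ A]
    {PA : Submodule ℂ (StrongDual ℂ A)} {φ : StrongDual ℂ (ULift.{v} A)} :
    φ ∈ liftPredual PA ↔ φ.comp (upCLM A) ∈ PA := Iff.rfl

variable {A : Type} [NonUnitalNormedRing A] [NormedSpace ℂ A] [IsScalarTower ℂ A A]
  [SMulCommClass ℂ A A]

/-- The bimodule `A` with left multiplication and the zero right action, placed in an arbitrary
universe by `ULift`. Its derivations include the identity map, which is inner at `a` exactly if
`a ∈ a A`. -/
noncomputable def leftModule (A : Type) [NonUnitalNormedRing A] [NormedSpace ℂ A]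
    [IsScalarTower ℂ A A] [SMulCommClass ℂ A A] : BanachBimodule A (ULift.{v} A) where
  lact := (ContinuousLinearMap.postcomp (ULift.{v} A) (upCLM.{v} A)).comp
    ((ContinuousLinearMap.precomp A (downCLM.{v} A)).comp (ContinuousLinearMap.mul ℂ A))
  ract := 0
  lact_mul a b x := by simp [mul_assoc]
  ract_mul a b x := by simp
  lact_ract a b x := by simp; rfl

@[simp] theorem leftModule_lact (a : A) (x : ULift.{v} A) :
    (leftModule A).lact a x = ⟨a * x.down⟩ := rfl

@[simp] theorem leftModule_ract (a : A) (x : ULift.{v} A) : (leftModule A).ract a x = 0 := rfl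

theorem leftModule_isPredual {PA : Submodule ℂ (StrongDual ℂ A)}
    (h : (BanachBimodule.self A).IsPredual PA) :
    (leftModule.{v} A).IsPredual (liftPredual PA) where
  isClosed := h.isClosed.preimage (ContinuousLinearMap.precomp ℂ (upCLM.{v} A)).continuous
  smul_mem a φ _ := by
    rw [mem_liftPredual]
    convert PA.zero_mem
    ext x
    simp
  mem_smul a φ hφ := h.mem_smul a _ hφ
  bijective := by
    constructor
    · intro x y hxy
      refine ULift.down_injective (h.bijective.1 ?_)
      ext φ
      exact DFunLike.congr_fun hxy (⟨φ.1.comp (downCLM A), φ.2⟩ : liftPredual PA)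
    · intro ψ
      let T : PA →L[ℂ] liftPredual.{v} PA :=
        ((ContinuousLinearMap.precomp ℂ (downCLM.{v} A)).comp PA.subtypeL).codRestrict
          (liftPredual PA) fun φ => φ.2
      obtain ⟨x, hx⟩ := h.bijective.2 (ψ.comp T)
      refine ⟨⟨x⟩, ?_⟩
      ext φ
      exact DFunLike.congr_fun hx (⟨φ.1.comp (upCLM A), φ.2⟩ : PA)

theorem leftModule_isNormal {PA : Submodule ℂ (StrongDual ℂ A)}
    (h : (BanachBimodule.self A).IsPredual PA) :
    (leftModule.{v} A).IsNormal PA (liftPredual PA) where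
  left x := continuous_wstar ((leftModule.{v} A).lact.flip x) fun φ hφ =>
    h.smul_mem x.down _ hφ
  right x := continuous_wstar ((leftModule.{v} A).ract.flip x) fun φ _ => by
    convert PA.zero_mem
    ext a
    simp

/-- The identity is a `w*`-continuous derivation into `leftModule A`, so pointwise Connes
amenability at `a` forces `a ∈ a A`. -/
theorem exists_eq_mul_of_pointwiseConnesAmenableAt {PA : Submodule ℂ (StrongDual ℂ A)}
    (hA : IsDualBanachAlgebra A PA) {a : A} (h : PointwiseConnesAmenableAt.{0, v} A PA a) :
    ∃ x, a = a * x := by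
  have := hA.1
  obtain ⟨x, hx⟩ := h (ULift.{v} A) (leftModule A) (liftPredual PA) (leftModule_isPredual hA.2)
    (leftModule_isNormal hA.2) (upCLM A) (fun a b => by simp)
    (continuous_wstar _ fun _ hφ => hφ)
  exact ⟨x.down, by simpa using congrArg ULift.down hx⟩

theorem ConnesAmenable.pointwise {A : Type u} [NonUnitalNormedRing A] [NormedSpace ℂ A]
    {PA : Submodule ℂ (StrongDual ℂ A)}
    (h : ConnesAmenable.{u, v} A PA) : PointwiseConnesAmenable.{u, v} A PA := by
  intro a E _ _ _ M P hP hN D hD hc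
  obtain ⟨x, hx⟩ := h E M P hP hN D hD hc
  exact ⟨x, hx a⟩

end LeftModule

namespace EllOneMin

variable {ω : ℕ → Set.Ici (1 : ℝ)}

theorem exists_forall_tail_ne_zero (ω : ℕ → Set.Ici (1 : ℝ)) :
    ∃ a : EllOneMin ω, ∀ n, tail n a ≠ 0 := by
  have hnorm : ∀ n, ‖(((1 / 2 : ℝ) ^ n / (ω n : ℝ) : ℝ) : ℂ)‖ * (ω n : ℝ) = (1 / 2) ^ n := by
    intro n
    have := pos ω n
    rw [Complex.norm_real, Real.norm_of_nonneg (by positivity), div_mul_cancel₀ _ this.ne']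
  refine ⟨mk (fun n => (((1 / 2 : ℝ) ^ n / (ω n : ℝ) : ℝ) : ℂ))
    (by simpa only [hnorm] using summable_geometric_two), fun n => ?_⟩
  set a : EllOneMin ω := mk _ _ with ha
  have h1 : ∀ k, (if n ≤ k then a k else 0) =
      ((if n ≤ k then (1 / 2 : ℝ) ^ k / (ω k : ℝ) else 0 : ℝ) : ℂ) := fun k => by
    split_ifs <;> simp [ha]
  have h2 := (summable_tail_norm n a).of_norm
  simp only [h1, Complex.summable_ofReal] at h2
  rw [tail, tsum_congr h1, ← Complex.ofReal_tsum, Complex.ofReal_ne_zero]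
  refine (h2.tsum_pos (fun k => ?_) n ?_).ne'
  · have := pos ω k
    split_ifs <;> positivity
  · have := pos ω n
    rw [if_pos le_rfl]
    positivity

theorem not_pointwiseConnesAmenable (hω : Tendsto (fun n => (ω n : ℝ)) atTop atTop) :
    ¬ PointwiseConnesAmenable.{0, v} (EllOneMin ω) (predual ω) := by
  intro h
  obtain ⟨a, ha⟩ := exists_forall_tail_ne_zero ω
  obtain ⟨x, hx⟩ := exists_eq_mul_of_pointwiseConnesAmenableAt
    ⟨inferInstance, isPredual_self hω⟩ (h a)
  -- If `a = a * x` and no tail of `a` vanishes, all tails of `x` are `1`; but they tend to `0`.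
  have h1 : ∀ n, tail n x = 1 := fun n => by
    have := congrArg (tail n) hx
    rw [tail_mul] at this
    exact mul_left_cancel₀ (ha n) (by rw [← this, mul_one])
  have := tendsto_tail x
  simp only [h1] at this
  exact one_ne_zero (tendsto_nhds_unique tendsto_const_nhds this)

end EllOneMin

/-! ### Derivations at idempotents -/

theorem tendsto_wstar {E : Type*} [NormedAddCommGroup E] [NormedSpace ℂ E]
    (P : Submodule ℂ (StrongDual ℂ E)) {ι : Type*} {l : Filter ι} {f : ι → E} {x : E}
    (h : Tendsto f l (𝓝 x)) : Tendsto f l (@nhds E (wstarTopology P) x) := by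
  rw [@nhds_induced, tendsto_comap_iff]
  exact tendsto_pi_nhds.2 fun φ => (φ.1.continuous.tendsto x).comp h

namespace BanachBimodule

variable {A : Type u} [NonUnitalNormedRing A] [NormedSpace ℂ A]
  {E : Type v} [NormedAddCommGroup E] [NormedSpace ℂ E]

/-- Let `p` be an eigenvector of multiplication by `a` with eigenvalue `c`, and `q` the quasi-inverse
of `c⁻¹ (a - a p)`. If `L p` fixes `z` and `R p` kills `z`, then `L a z = c z`, whereas `R a` acts on
`z` as `R (a - a p)`, for which `c` is not a spectral value; so `L a - R a` can be inverted at `z`.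
-/
theorem exists_commutator_eq (hcomm : ∀ a b : A, a * b = b * a) {L R : A →L[ℂ] E →L[ℂ] E}
    (hL : ∀ a b x, L (a * b) x = L a (L b x)) (hR : ∀ a b x, R (a * b) x = R a (R b x))
    (hLR : ∀ a b x, L a (R b x) = R b (L a x)) {a p q : A} {c : ℂ} (hc : c ≠ 0)
    (hap : a * p = c • p) (hq : c • q + (a - a * p) - (a - a * p) * q = 0)
    {z : E} (hLz : L p z = z) (hRz : R p z = 0) : ∃ x, L a x - R a x = z := by
  have h1 : L a z = c • z := by
    conv_lhs => rw [← hLz]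
    rw [← hL, hap, map_smul, smul_apply, hLz]
  have h2 : R (a * p) z = 0 := by rw [hR, hRz, map_zero]
  have h3 : R (a * p * q) z = 0 := by
    rw [mul_assoc, hcomm p q, ← mul_assoc, hR, hRz, map_zero]
  have h4 := congrArg (fun b => R b z) hq
  simp only [map_add, map_sub, map_smul, sub_mul, map_zero, add_apply, sub_apply, smul_apply,
    zero_apply, h2, h3, sub_zero, hR a q] at h4
  refine ⟨c⁻¹ • (z - R q z), ?_⟩
  have h5 : R a z - R a (R q z) = -(c • R q z) := by
    rw [eq_neg_iff_add_eq_zero, ← h4]; abel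
  rw [map_smul, map_smul, ← smul_sub, map_sub, map_sub, hLR, h1, map_smul, h5, sub_neg_eq_add,
    sub_add_cancel, inv_smul_smul₀ hc]

variable {M : BanachBimodule A E}

/-- The subspace `{a · x - x · a}` of values at `a` of inner derivations. -/
noncomputable def adRange (M : BanachBimodule A E) (a : A) : Submodule ℂ E :=
  LinearMap.range (M.lact a - M.ract a).toLinearMap

theorem mem_adRange {a : A} {y : E} : y ∈ M.adRange a ↔ ∃ x, M.lact a x - M.ract a x = y :=
  Iff.rfl

/-- A derivation is exactly inner at an idempotent `p`, with a commutator of `a`, if `p` splits off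
an eigenvalue `c ≠ 0` of `a`: as `p · D p · p = 0`, the two terms of
`D p = D p · p + p · D p` satisfy the hypotheses of `exists_commutator_eq`, for the two orders of the
left and the right action. -/
theorem IsDerivation.mem_adRange_of_isIdempotentElem (hcomm : ∀ a b : A, a * b = b * a)
    {D : A →L[ℂ] E} (hD : M.IsDerivation D) {a p q : A} {c : ℂ} (hc : c ≠ 0)
    (hp : p * p = p) (hap : a * p = c • p)
    (hq : c • q + (a - a * p) - (a - a * p) * q = 0) : D p ∈ M.adRange a := by
  have hR : ∀ a b x, M.ract (a * b) x = M.ract a (M.ract b x) := fun a b x => by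
    rw [hcomm, M.ract_mul]
  have hLL : ∀ x, M.lact p (M.lact p x) = M.lact p x := fun x => by rw [← M.lact_mul, hp]
  have hRR : ∀ x, M.ract p (M.ract p x) = M.ract p x := fun x => by rw [← hR, hp]
  have h := hD p p
  rw [hp] at h
  have h0 : M.lact p (M.ract p (D p)) = 0 := by
    have h' := congrArg (M.lact p) h
    rwa [map_add, hLL, right_eq_add] at h'
  obtain ⟨x, hx⟩ := exists_commutator_eq hcomm M.lact_mul hR M.lact_ract hc hap hq
    (hLL (D p)) (by rw [← M.lact_ract, h0])
  obtain ⟨y, hy⟩ := exists_commutator_eq hcomm hR M.lact_mul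
    (fun a b x => (M.lact_ract b a x).symm) hc hap hq (hRR (D p)) h0
  rw [h]
  refine Submodule.add_mem _ (mem_adRange.2 ⟨-y, ?_⟩) ⟨x, hx⟩
  rw [map_neg, map_neg, ← hy]; abel

theorem isWStarApproxInnerAt_of_tendsto {D : A →L[ℂ] E} {a : A} {b : ℕ → A}
    (hb : Tendsto b atTop (𝓝 a)) (h : ∀ n, D (b n) ∈ M.adRange a)
    (P : Submodule ℂ (StrongDual ℂ E)) : M.IsWStarApproxInnerAt P D a := by
  choose x hx using fun n => mem_adRange.1 (h n)
  refine ⟨ULift.{v} ℕ, inferInstance, inferInstance, inferInstance, fun n => x n.down, ?_⟩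
  simp only [hx]
  have hdown : Tendsto (ULift.down : ULift.{v} ℕ → ℕ) atTop atTop :=
    tendsto_atTop_atTop.2 fun n => ⟨⟨n⟩, fun _ h => h⟩
  exact tendsto_wstar P (((D.continuous.tendsto a).comp hb).comp hdown)

end BanachBimodule

/-! ### A Lipschitz truncation of the complex plane -/

/-- The nearest-point projection onto the square `|re z|, |im z| ≤ ε` (for `ε ≥ 0`). -/
noncomputable def Complex.clip (ε : ℝ) (z : ℂ) : ℂ :=
  ⟨max (-ε) (min ε z.re), max (-ε) (min ε z.im)⟩

theorem abs_max_neg_min_sub_le (ε x y : ℝ) :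
    |max (-ε) (min ε x) - max (-ε) (min ε y)| ≤ |x - y| := by
  rcases abs_cases (x - y) with h | h <;> rw [abs_le] <;> constructor <;>
    simp only [max_def, min_def] <;> split_ifs <;> linarith

theorem Complex.norm_clip_sub_le (ε : ℝ) (z w : ℂ) : ‖clip ε z - clip ε w‖ ≤ 2 * ‖z - w‖ := by
  have h1 := Complex.norm_le_abs_re_add_abs_im (clip ε z - clip ε w)
  have h2 := abs_max_neg_min_sub_le ε z.re w.re
  have h3 := abs_max_neg_min_sub_le ε z.im w.im
  have h4 := Complex.abs_re_le_norm (z - w)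
  have h5 := Complex.abs_im_le_norm (z - w)
  simp only [clip, Complex.sub_re, Complex.sub_im] at *
  linarith

theorem Complex.norm_clip_le {ε : ℝ} (hε : 0 ≤ ε) (z : ℂ) : ‖clip ε z‖ ≤ 2 * ε := by
  have h1 := Complex.norm_le_abs_re_add_abs_im (clip ε z)
  have h : ∀ x : ℝ, |max (-ε) (min ε x)| ≤ ε := fun x =>
    abs_le.2 ⟨le_max_left _ _, max_le (by linarith) (min_le_left _ _)⟩
  have h2 := h z.re
  have h3 := h z.im
  simp only [clip] at *
  linarith

theorem Complex.clip_eq_self {ε : ℝ} {z : ℂ} (h : ‖z‖ ≤ ε) : clip ε z = z := by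
  have h4 := abs_le.1 ((Complex.abs_re_le_norm z).trans h)
  have h5 := abs_le.1 ((Complex.abs_im_le_norm z).trans h)
  apply Complex.ext <;> simp [clip, *]

/-! ### Spectral idempotents and approximation -/

namespace EllOneMin

variable {ω : ℕ → Set.Ici (1 : ℝ)}

theorem tail_sub (n : ℕ) (f g : EllOneMin ω) : tail n (f - g) = tail n f - tail n g := by
  rw [eq_sub_iff_add_eq, ← tail_add, sub_add_cancel]

theorem tail_sum {ι : Type*} (n : ℕ) (s : Finset ι) (f : ι → EllOneMin ω) :
    tail n (∑ i ∈ s, f i) = ∑ i ∈ s, tail n (f i) := by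
  classical
  induction s using Finset.induction_on with
  | empty => simp [tail_zero]
  | insert i s hi ih => rw [Finset.sum_insert hi, Finset.sum_insert hi, tail_add, ih]

/-- The spectral idempotent of `a` at `c ≠ 0`. -/
theorem exists_tail_eq_indicator (a : EllOneMin ω) {c : ℂ} (hc : c ≠ 0) :
    ∃ p : EllOneMin ω, ∀ n, tail n p = if tail n a = c then 1 else 0 := by
  obtain ⟨N, hN⟩ := eventually_atTop.1 ((tendsto_tail a).eventually_ne hc.symm)
  refine exists_tail_eq (tendsto_const_nhds.congr' ?_) (summable_of_ne_finset_zero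
    (s := Finset.range N) fun n hn => ?_)
  · filter_upwards [eventually_ge_atTop N] with n hn
    rw [if_neg (hN n hn)]
  · have hn : N ≤ n := by simpa using hn
    rw [if_neg (hN n hn), if_neg (hN (n + 1) (by omega))]
    simp

/-- The quasi-inverse `u / (u - 1)` of `u = c⁻¹ (a - a p)`, where `p` is the spectral idempotent of
`a` at `c`. The weighted variation is finite since `z ↦ z / (z - c)` is Lipschitz near `0`, and the
tails of `a` are eventually near `0`. -/
theorem exists_quasiInverse_tail (a : EllOneMin ω) {c : ℂ} (hc : c ≠ 0) :
    ∃ q : EllOneMin ω, ∀ n, tail n q =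
      if tail n a = c then 0 else tail n a / (tail n a - c) := by
  have hc' : 0 < ‖c‖ / 2 := by positivity
  obtain ⟨N, hN⟩ := Metric.tendsto_atTop.1 (tendsto_tail a) (‖c‖ / 2) hc'
  have hlow : ∀ n ≥ N, ‖c‖ / 2 ≤ ‖tail n a - c‖ := fun n hn => by
    have h1 := hN n hn
    rw [dist_zero_right] at h1
    have h2 := norm_sub_norm_le c (tail n a)
    rw [norm_sub_rev] at h2
    linarith
  have hne : ∀ n ≥ N, tail n a - c ≠ 0 := fun n hn =>
    norm_pos_iff.1 (hc'.trans_le (hlow n hn))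
  refine exists_tail_eq ?_ ?_
  · have h := (tendsto_tail a).div ((tendsto_tail a).sub_const c) (by simpa using hc)
    rw [zero_div] at h
    refine h.congr' ?_
    filter_upwards [eventually_ge_atTop N] with n hn
    rw [if_neg (sub_ne_zero.1 (hne n hn))]
    rfl
  · refine Summable.of_norm_bounded_eventually_nat (a.summable_tail.mul_left (4 / ‖c‖)) ?_
    filter_upwards [eventually_ge_atTop N] with n hn
    have hn' : n + 1 ≥ N := by omega
    rw [if_neg (sub_ne_zero.1 (hne n hn)), if_neg (sub_ne_zero.1 (hne _ hn')),
      Real.norm_of_nonneg (mul_nonneg (norm_nonneg _) (pos ω n).le), ← _root_.mul_assoc]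
    refine mul_le_mul_of_nonneg_right ?_ (pos ω n).le
    have h1 : tail n a / (tail n a - c) - tail (n + 1) a / (tail (n + 1) a - c) =
        c * (tail (n + 1) a - tail n a) / ((tail n a - c) * (tail (n + 1) a - c)) := by
      rw [div_sub_div _ _ (hne n hn) (hne _ hn')]
      ring
    rw [h1, norm_div, norm_mul, norm_mul, norm_sub_rev (tail (n + 1) a),
      div_le_iff₀ (mul_pos (norm_pos_iff.2 (hne n hn)) (norm_pos_iff.2 (hne _ hn')))]
    have h2 : ‖c‖ / 2 * (‖c‖ / 2) ≤ ‖tail n a - c‖ * ‖tail (n + 1) a - c‖ :=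
      mul_le_mul (hlow n hn) (hlow _ hn') hc'.le (norm_nonneg _)
    calc ‖c‖ * ‖tail n a - tail (n + 1) a‖
        = 4 / ‖c‖ * ‖tail n a - tail (n + 1) a‖ * (‖c‖ / 2 * (‖c‖ / 2)) := by
          field_simp; norm_num
      _ ≤ _ := by gcongr

variable {E : Type v} [NormedAddCommGroup E] [NormedSpace ℂ E]
  {M : BanachBimodule (EllOneMin ω) E} {D : EllOneMin ω →L[ℂ] E}

/-- If `b = h(a)` in the functional calculus on tails, with `h = 0` near `0`, then `D b` is a
commutator of `a`: such `b` is a finite linear combination of spectral idempotents of `a`. -/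
theorem derivation_mem_adRange_of_tail_eq (hD : M.IsDerivation D) {a b : EllOneMin ω} {h : ℂ → ℂ}
    {ε : ℝ} (hε : 0 < ε) (h0 : ∀ z, ‖z‖ ≤ ε → h z = 0) (hb : ∀ n, tail n b = h (tail n a)) :
    D b ∈ M.adRange a := by
  classical
  obtain ⟨N, hN⟩ := Metric.tendsto_atTop.1 (tendsto_tail a) ε hε
  -- From `N` on, `h` vanishes at the tails of `a`, so finitely many spectral values matter.
  set Λ : Finset ℂ := ((Finset.range N).image fun n => tail n a).filter (· ≠ 0) with hΛ
  have hex : ∀ c : ℂ, ∃ p : EllOneMin ω, c ≠ 0 → ∀ n, tail n p = if tail n a = c then 1 else 0 :=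
    fun c => by
      by_cases hc : c = 0
      · exact ⟨0, fun h => (h hc).elim⟩
      · exact (exists_tail_eq_indicator a hc).imp fun p hp _ => hp
  choose p hp using hex
  have hsum : b = ∑ c ∈ Λ, h c • p c := by
    refine eq_of_tail fun n => ?_
    have h1 : ∀ c ∈ Λ, tail n (h c • p c) = if tail n a = c then h c else 0 := fun c hc => by
      rw [tail_smul, hp c (Finset.mem_filter.1 hc).2]
      simp
    rw [tail_sum, Finset.sum_congr rfl h1, Finset.sum_ite_eq, hb]
    split_ifs with hmem
    · rfl
    · by_cases hz : tail n a = 0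
      · rw [hz]
        exact h0 0 (by simpa using hε.le)
      · have hn : N ≤ n := by
          by_contra hn
          exact hmem (Finset.mem_filter.2
            ⟨Finset.mem_image_of_mem _ (Finset.mem_range.2 (not_le.1 hn)), hz⟩)
        exact h0 _ (by simpa using (hN n hn).le)
  rw [hsum, map_sum]
  refine Submodule.sum_mem _ fun c hc => ?_
  rw [map_smul]
  refine Submodule.smul_mem _ _ ?_
  have hc0 := (Finset.mem_filter.1 hc).2
  obtain ⟨q, hq⟩ := exists_quasiInverse_tail a hc0
  refine hD.mem_adRange_of_isIdempotentElem EllOneMin.mul_comm hc0 (q := q)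
    (eq_of_tail fun n => ?_) (eq_of_tail fun n => ?_) (eq_of_tail fun n => ?_)
  · rw [tail_mul, hp c hc0]
    simp
  · rw [tail_mul, tail_smul, hp c hc0]
    split_ifs with hn <;> simp [hn]
  · simp only [tail_mul, tail_sub, tail_add, tail_smul, tail_zero, hp c hc0, hq]
    split_ifs with hn
    · simp
    · have := sub_ne_zero.2 hn
      field_simp
      ring

/-- Truncating `a` by `z ↦ z - clip ε z` as `ε → 0` gives a norm approximation: the error `clip ε (a)`
tends to `0` by dominated convergence, as `clip ε` is Lipschitz uniformly in `ε`. -/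
theorem exists_seq_tendsto_derivation_mem_adRange (hD : M.IsDerivation D) (a : EllOneMin ω) :
    ∃ b : ℕ → EllOneMin ω, Tendsto b atTop (𝓝 a) ∧ ∀ k, D (b k) ∈ M.adRange a := by
  have hε : ∀ k : ℕ, (0 : ℝ) < 1 / (k + 1) := fun k => Nat.one_div_pos_of_nat
  have hbound : ∀ (k n : ℕ), ‖Complex.clip (1 / (k + 1)) (tail n a) -
      Complex.clip (1 / (k + 1)) (tail (n + 1) a)‖ * (ω n : ℝ) ≤
      2 * (‖tail n a - tail (n + 1) a‖ * (ω n : ℝ)) := fun k n => by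
    rw [← _root_.mul_assoc]
    exact mul_le_mul_of_nonneg_right (Complex.norm_clip_sub_le _ _ _) (pos ω n).le
  have hex : ∀ k : ℕ, ∃ r : EllOneMin ω, ∀ n,
      tail n r = Complex.clip (1 / (k + 1)) (tail n a) := fun k => by
    refine exists_tail_eq ?_ (.of_nonneg_of_le
      (fun n => mul_nonneg (norm_nonneg _) (pos ω n).le) (hbound k) (a.summable_tail.mul_left 2))
    refine (tendsto_tail a).congr' ?_
    obtain ⟨N, hN⟩ := Metric.tendsto_atTop.1 (tendsto_tail a) _ (hε k)
    filter_upwards [eventually_ge_atTop N] with n hn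
    exact (Complex.clip_eq_self (by simpa using (hN n hn).le)).symm
  choose r hr using hex
  have hlim : Tendsto (fun k : ℕ => 2 * (1 / ((k : ℝ) + 1))) atTop (𝓝 0) := by
    simpa using (tendsto_one_div_add_atTop_nhds_zero_nat (𝕜 := ℝ)).const_mul 2
  have hr0 : Tendsto r atTop (𝓝 0) := by
    rw [tendsto_zero_iff_norm_tendsto_zero]
    simp only [norm_eq_tsum_tail, hr]
    rw [← tsum_zero (α := ℝ) (β := ℕ)]
    refine tendsto_tsum_of_dominated_convergence (a.summable_tail.mul_left 2) (fun n => ?_)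
      (.of_forall fun k n => ?_)
    · have hclip : ∀ m, Tendsto (fun k : ℕ => Complex.clip (1 / ((k : ℝ) + 1)) (tail m a))
          atTop (𝓝 0) := fun m =>
        squeeze_zero_norm (fun k => Complex.norm_clip_le (hε k).le _) hlim
      simpa using ((hclip n).sub (hclip (n + 1))).norm.mul_const (ω n : ℝ)
    · rw [Real.norm_of_nonneg (mul_nonneg (norm_nonneg _) (pos ω n).le)]
      exact hbound k n
  refine ⟨fun k => a - r k, by simpa using hr0.const_sub a, fun k => ?_⟩
  refine derivation_mem_adRange_of_tail_eq hD (h := fun z => z - Complex.clip (1 / (k + 1)) z)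
    (hε k) (fun z hz => ?_) fun n => ?_
  · rw [Complex.clip_eq_self hz, sub_self]
  · rw [tail_sub, hr]

end EllOneMin

theorem theorem3p2 (ω : ℕ → Set.Ici (1 : ℝ))
    (hω : Tendsto (fun n => (ω n : ℝ)) atTop atTop) :
    IsDualBanachAlgebra (EllOneMin ω) (EllOneMin.predual ω) ∧
    ¬ ConnesAmenable.{0, v} (EllOneMin ω) (EllOneMin.predual ω) ∧
    ¬ PointwiseConnesAmenable.{0, v} (EllOneMin ω) (EllOneMin.predual ω) ∧
    PointwiseWStarApproxConnesAmenable.{0, v} (EllOneMin ω) (EllOneMin.predual ω) := by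
  have h := EllOneMin.not_pointwiseConnesAmenable.{v} hω
  refine ⟨⟨inferInstance, EllOneMin.isPredual_self hω⟩, fun hC => h hC.pointwise, h, ?_⟩
  intro a E _ _ _ M P _ _ D hD _
  obtain ⟨b, hb, hmem⟩ := EllOneMin.exists_seq_tendsto_derivation_mem_adRange hD a
  exact BanachBimodule.isWStarApproxInnerAt_of_tendsto hb hmem P
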